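/- **Theorem (Safety of Hamster under standard synchrony).** Let $n>2f$, let $\Delta>0$, and consider an execution of the protocol described below with $n$ nodes, at most $f$ of them Byzantine, over authenticated point-to-point channels that deliver every message between honest nodes within time $\Delta$, with unforgeable signatures. Assume that the hash function has no collision among the inputs on which honest nodes evaluate it during the execution. Then: 1. (Safety) No two honest nodes commit different full blocks at the same height: if honest nodes $r,r'$ commit, in the Follow phase, the full blocks $B,B'$ at the same height $h$, then $B=B'$. 2. (Consistent distributing) If an honest node distributes the $(n,f+1)$-coded segments of a block $B$, with their Merkle proofs, for an identifier block $I$ containing $H(B)$, then every honest node eventually collects $f+1$ correct follow messages with distinct segments for $I$ that decode to $B$, and no $f+1$ correct follow messages with distinct segments for $I$ collected by an honest node decode to a block other than $B$. *Data.* A block is $B_h=(b_h,H(B_{h-1}))$, with $B_1=(b_1,\perp)$. It is serialized into $f+1$ chunks of equal length over a field, which are encoded by a systematic $(n,f+1)$ Reed–Solomon code into chunks $y^1,\dots,y^n$; $H(B_h)$ is the root of the Merkle tree with leaves $\mathrm{hash}(i\,|\,y^i)$. The identifier block is $I_h=(H(B_h),H(I_{h-1}))$, with $I_1=(H(B_1),\perp)$,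 and the segment of node $r$ is $Y_h^r=(r,y_h^r,I_h)$. The extension relation is the reflexive-transitive closure of "is the identifier block of the next height that contains the hash of"; $\perp$ counts as the predecessor of $I_1$ and has height $0$. A certificate $C_v(I)$ consists of votes for $I$ in view $v$ by at least $f+1$ distinct nodes; $C_0(\perp)$ is valid without votes. Certificates are ranked by (view, height), lexicographically. A follow message is a segment with a Merkle proof; it is correct if the proof verifies against the root in its $I_h$. *Protocol for honest nodes.* Nodes start in view $0$, have a fixed leader for each view, and ignore illegal messages. A legal proposal of view $v$ carries a segment $Y_h^r$ and a certificate $C_v(I_{h-1})$ for the predecessor of $I_h$; a legal new-view message of view $v$ carries a valid certificate of an earlier view; both are signed by the leader of $v$. - *Propose.* An honest leader of $v$ that holds $C_v(I_{h-1})$ may propose correctly encoded segments of a single block of height $h$. - *Re-propose.* In view $v$, a node that receives a proposal of height $h$ forwards one to all nodes, and also one that carries its own segment if it gets one. - *Vote.* In view $v$, a node votes for $I_h$ when it has $f+1$ proposals of view $v$ with distinct segments for $I_h$ that decode to a block $B$ with $H(B)$ equal to the root in $I_h$. - *Commit on $I_h$.* A node directly commits on $I_h$ when it has received, while in view $v$,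 a proposal of view $v$ carrying $C_v(I_h)$, and is still in view $v$ a time $2\Delta$ later. It then also commits on every identifier block that $I_h$ extends. - *View change.* Evidence against the leader of $v$ is: two legal proposals or new-view messages of view $v$ signed by it whose identifier blocks do not extend one another; or $f+1$ of its proposals with distinct segments for one $I$ that do not decode to a block identified by $I$; or $f+1$ blames of view $v$ by distinct nodes. A node may blame if it has not voted $p$ times during $(3p+4)\Delta$ spent in the view. As soon as a node in view $v$ has evidence, found or received in a quit-view message, it broadcasts a quit-view message with valid evidence, locks on a highest certificate it holds, sends it to the leader of $v+1$, and enters view $v+1$. After $2\Delta$ in its view the new leader may broadcast one new-view message with the highest certificate it holds. A node in that view that receives a new-view message whose certificate ranks at least as high as its lock forwards it and votes for the certified identifier block in the new view. - *Follow.* A node that has committed on $I_h$ and has decoded from proposals a block $B_h$ with $H(B_h)$ equal to the root in $I_h$ sends to each node $i$ the $i$-th segment of $B_h$ with its Merkle proof. A node that receives a correct follow message with its own segment forwards it to all nodes. A node that has committed on $I_h$ and has collected $f+1$ correct follow messages with distinct segments for $I_h$ decodes them and commits the result as the full block of height $h$. Messages that arrive at a time $t$ are processed before timers that end at $t$. Leaders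 need not issue proposals or new-view messages, and nodes need not issue blames. -/

import Mathlib

/-! The Hamster protocol under standard synchrony: data structures, coding, Merkle trees,
timed executions with Byzantine nodes, and the Steady-State, View-Change and Follow phases. -/

namespace Hamster

/-! ### Data structures -/

/-- Binary trees with labelled leaves (the shape of a Merkle tree). -/
inductive BinTree (α : Type) where
  | leaf (a : α) : BinTree α
  | node (l r : BinTree α) : BinTree α

/-- The leaves of a tree, from left to right. -/
def BinTree.leaves {α : Type} : BinTree α → List α
  | .leaf a => [a]
  | .node l r => l.leaves ++ r.leaves

/-- A full block `B_h = (b_h, H(B_{h-1}))`; `prev = none` stands for `⊥`. -/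
structure Block (Req D : Type*) where
  batch : Req
  prev : Option D

/-- An identifier block `I_h = (H(B_h), H(I_{h-1}))`. The field `height` is the subscript `h`;
`prev = none` stands for `⊥`. -/
structure IdBlock (D : Type*) where
  height : ℕ
  root : D
  prev : Option D

/-- An identifier block, or `none` for the empty chain `⊥`, the predecessor of `I_1`. -/
abbrev Tip (D : Type*) := Option (IdBlock D)

/-- The height of an identifier block; `⊥` has height `0`. -/
def Tip.height {D : Type*} : Tip D → ℕ
  | none => 0
  | some I => I.height

/-- What is fed to the hash function: `i | y_i` at a Merkle leaf, the concatenation of the two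
children's values at an inner Merkle node, and an identifier block. -/
inductive HashInput (n L : ℕ) (F D : Type*) where
  | leaf (i : Fin n) (y : Fin L → F)
  | node (a b : D)
  | ident (root : D) (prev : Option D)

/-- The hash input of an identifier block. -/
def IdBlock.input {D : Type*} (n L : ℕ) (F : Type*) (I : IdBlock D) : HashInput n L F D :=
  .ident I.root I.prev

/-- A segment `Y_h^r = (r, y_h^r, I_h)`. -/
structure Segment (n L : ℕ) (F D : Type*) where
  idx : Fin n
  chunk : Fin L → F
  ident : IdBlock D

/-- A certificate `C_v(I)`: the votes of the nodes in `signers` for `block` in view `view`. -/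
structure Cert (n : ℕ) (D : Type*) where
  block : Tip D
  view : ℕ
  signers : Finset (Fin n)

/-- The rank `(v, h)` of a certificate, ordered lexicographically. -/
def Cert.rank {n : ℕ} {D : Type*} (c : Cert n D) : ℕ ×ₗ ℕ :=
  toLex (c.view, c.block.height)

/-- The initial certificate `C_0(⊥)`, which needs no votes. -/
def Cert.IsGenesis {n : ℕ} {D : Type*} (c : Cert n D) : Prop :=
  c.block = none ∧ c.view = 0

/-- The content `⟨proposal, Y, v, C⟩` of a proposal. -/
structure Proposal (n L : ℕ) (F D : Type*) where
  seg : Segment n L F D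
  view : ℕ
  cert : Cert n D

/-- The two kinds of statements made by the leader of a view. -/
inductive LeaderMsg (n L : ℕ) (F D : Type*) where
  | proposal (p : Proposal n L F D)
  | newView (v : ℕ) (c : Cert n D)

namespace LeaderMsg
variable {n L : ℕ} {F D : Type*}

def view : LeaderMsg n L F D → ℕ
  | proposal p => p.view
  | newView v _ => v

def cert : LeaderMsg n L F D → Cert n D
  | proposal p => p.cert
  | newView _ c => c

/-- The identifier block that the leader puts forward. -/
def tip : LeaderMsg n L F D → Tip D
  | proposal p => some p.seg.ident
  | newView _ c => c.block

end LeaderMsg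

/-- Evidence against the leader of a view: two conflicting messages of the leader; proposals
`q i`, `i ∈ S`, for one identifier block `I` that decode to something that `I` does not
identify; blames signed by the nodes in `S`. -/
inductive Evidence (n L : ℕ) (F D : Type*) where
  | equivocation (a b : LeaderMsg n L F D)
  | error (I : IdBlock D) (S : Finset (Fin n)) (q : Fin n → Proposal n L F D)
  | silence (S : Finset (Fin n))

/-- The statements that nodes sign. -/
inductive Stmt (n L : ℕ) (F D : Type*) where
  | lead (m : LeaderMsg n L F D)
  | vote (X : Tip D) (v : ℕ)
  | status (v : ℕ) (c : Cert n D)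
  | blame (v : ℕ)
  | quitView (v : ℕ) (e : Evidence n L F D)

/-- Network messages: a statement with the signature of `s`, or a follow message consisting of a
segment and a Merkle proof. -/
inductive Msg (n L : ℕ) (F D : Type*) where
  | signed (s : Fin n) (st : Stmt n L F D)
  | follow (Y : Segment n L F D) (π : List D)

/-! ### Parameters of the system -/

/-- The public parameters: `n` nodes of which at most `f < n/2` are faulty, the synchronous
bound `Δ`, the parameter `p` of the silence rule, the evaluation points of the Reed-Solomon code
over `F`, the layout that serializes a block and divides it evenly into `f+1` chunks of `L`
symbols, the hash function, and the shape of the Merkle tree on the `n` chunks. -/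
structure Config (n f L : ℕ) (F Req D : Type*) [Field F] where
  resilience : 2 * f < n
  Δ : ℝ
  Δ_pos : 0 < Δ
  p : ℕ
  point : Fin n ↪ F
  layout : Block Req D ↪ (Fin (f + 1) → Fin L → F)
  hash : HashInput n L F D → D
  shape : BinTree (Fin n)
  shape_leaves : shape.leaves = List.finRange n

namespace Config
variable {n f L : ℕ} {F Req D : Type*} [Field F] (cfg : Config n f L F Req D)

/-- The leader of view `v` (nodes are numbered from `0`). -/
def leader (v : ℕ) : Fin n :=
  ⟨v % n, Nat.mod_lt _ (Nat.zero_lt_of_lt cfg.resilience)⟩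

/-! #### The systematic `(n, f+1)` Reed-Solomon code -/

/-- The evaluation points of the `f+1` systematic positions. -/
def sysPoint (k : Fin (f + 1)) : F :=
  cfg.point (Fin.castLE (by have := cfg.resilience; omega) k)

/-- The chunks `y^1, …, y^n` of a block. Symbol by symbol, they are the values at all `n` points of
the polynomial of degree at most `f` that takes the values of the block at the systematic points. -/
noncomputable def encode (B : Block Req D) (i : Fin n) (l : Fin L) : F :=
  (Lagrange.interpolate Finset.univ cfg.sysPoint (fun k => cfg.layout B k l)).eval (cfg.point i)

/-- Erasure decoding of the chunks `y i`, `i ∈ S`, yields the block `B`. -/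
def DecodesTo (S : Finset (Fin n)) (y : Fin n → Fin L → F) (B : Block Req D) : Prop :=
  S.card = f + 1 ∧ ∀ k l,
    cfg.layout B k l = (Lagrange.interpolate S cfg.point (fun i => y i l)).eval (cfg.sysPoint k)

/-! #### Merkle trees -/

/-- The value of the root of the Merkle tree of shape `T` over `y`. -/
def merkleOf (y : Fin n → Fin L → F) : BinTree (Fin n) → D
  | .leaf i => cfg.hash (.leaf i (y i))
  | .node l r => cfg.hash (.node (merkleOf y l) (merkleOf y r))

/-- All inputs hashed when that tree is computed. -/
def merkleInputs (y : Fin n → Fin L → F) : BinTree (Fin n) → Set (HashInput n L F D)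
  | .leaf i => {.leaf i (y i)}
  | .node l r => merkleInputs y l ∪ merkleInputs y r ∪
      {.node (cfg.merkleOf y l) (cfg.merkleOf y r)}

/-- The Merkle proof of position `i`: the siblings on the path from the root to leaf `i`. -/
def proofOf (y : Fin n → Fin L → F) (i : Fin n) : BinTree (Fin n) → List D
  | .leaf _ => []
  | .node l r =>
      if i ∈ l.leaves then cfg.merkleOf y r :: proofOf y i l
      else cfg.merkleOf y l :: proofOf y i r

/-- The root recomputed from a chunk `y` at position `i` and a Merkle proof (`none` if the proof
has the wrong length). -/
def recompute (i : Fin n) (y : Fin L → F) : BinTree (Fin n) → List D → Option D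
  | .leaf j, [] => if j = i then some (cfg.hash (.leaf i y)) else none
  | .node l r, d :: π =>
      if i ∈ l.leaves then (recompute i y l π).map (fun a => cfg.hash (.node a d))
      else (recompute i y r π).map (fun a => cfg.hash (.node d a))
  | .leaf _, _ :: _ => none
  | .node _ _, [] => none

/-- All inputs hashed in that recomputation. -/
def recomputeInputs (i : Fin n) (y : Fin L → F) :
    BinTree (Fin n) → List D → Set (HashInput n L F D)
  | .leaf _, [] => {.leaf i y}
  | .node l r, d :: π =>
      if i ∈ l.leaves then
        recomputeInputs i y l π ∪ {x | ∃ a, cfg.recompute i y l π = some a ∧ x = .node a d}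
      else
        recomputeInputs i y r π ∪ {x | ∃ a, cfg.recompute i y r π = some a ∧ x = .node d a}
  | .leaf _, _ :: _ => ∅
  | .node _ _, [] => ∅

/-- The identifier `H(B)` of a block: the Merkle root of its `n` chunks. -/
noncomputable def blockRoot (B : Block Req D) : D :=
  cfg.merkleOf (cfg.encode B) cfg.shape

/-- A segment with a Merkle proof is correct: it passes verification against its `I_h`. -/
def Correct (Y : Segment n L F D) (π : List D) : Prop :=
  cfg.recompute Y.idx Y.chunk cfg.shape π = some Y.ident.root

/-- The segment of node `i` of a block `B` with identifier block `I`. -/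
noncomputable def segment (B : Block Req D) (I : IdBlock D) (i : Fin n) : Segment n L F D :=
  ⟨i, cfg.encode B i, I⟩

/-! #### Legal format -/

/-- `H(I)`, with `H(⊥) = ⊥`. -/
def tipHash (X : Tip D) : Option D :=
  X.map (fun I => cfg.hash (I.input n L F))

/-- `I` contains the identifier of `X` and has the next height. -/
def Links (I : IdBlock D) (X : Tip D) : Prop :=
  I.prev = cfg.tipHash X ∧ I.height = X.height + 1

end Config

/-- A certificate is valid if it packages votes of `f+1` distinct nodes, or is initial. -/
def Cert.Valid {n : ℕ} {D : Type*} (f : ℕ) (c : Cert n D) : Prop :=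
  c.IsGenesis ∨ f + 1 ≤ c.signers.card

section Legal
variable {n f L : ℕ} {F Req D : Type*} [Field F] (cfg : Config n f L F Req D)

/-- A proposal in view `v` for `I_h` carries a certificate `C_v(I_{h-1})`; a new-view message of
view `v` carries a certificate from an earlier view. -/
def LeaderMsg.Legal : LeaderMsg n L F D → Prop
  | .proposal p => p.cert.Valid f ∧ p.cert.view = p.view ∧ cfg.Links p.seg.ident p.cert.block
  | .newView v c => c.Valid f ∧ c.view < v

/-- A statement of the leader together with the leader's signature. -/
def LeaderMsg.toMsg (m : LeaderMsg n L F D) : Msg n L F D :=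
  .signed (cfg.leader m.view) (.lead m)

/-- The signed messages that make up evidence against the leader of view `v`. -/
def Evidence.parts (v : ℕ) : Evidence n L F D → Set (Msg n L F D)
  | .equivocation a b =>
      {.signed (cfg.leader v) (.lead a), .signed (cfg.leader v) (.lead b)}
  | .error _ S q => {m | ∃ i ∈ S, m = .signed (cfg.leader v) (.lead (.proposal (q i)))}
  | .silence S => {m | ∃ s ∈ S, m = .signed s (.blame v)}

/-- The certificates carried by a statement. -/
def Stmt.certs : Stmt n L F D → Set (Cert n D)
  | .lead m => {m.cert}
  | .status _ c => {c}
  | _ => ∅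

/-- The signature of `s` on `st` occurs in the given message, possibly inside a certificate or
inside evidence. -/
inductive Msg.Carries (s : Fin n) (st : Stmt n L F D) : Msg n L F D → Prop
  | self : Msg.Carries s st (.signed s st)
  | cert (s' : Fin n) (st' : Stmt n L F D) (c : Cert n D) (hc : c ∈ st'.certs)
      (hs : s ∈ c.signers) (hst : st = .vote c.block c.view) : Msg.Carries s st (.signed s' st')
  | evidence (s' : Fin n) (v : ℕ) (e : Evidence n L F D) (m : Msg n L F D)
      (hm : m ∈ e.parts cfg v) (h : Msg.Carries s st m) :
      Msg.Carries s st (.signed s' (.quitView v e))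

/-- The identifier blocks mentioned in a statement of the leader. -/
def LeaderMsg.tips (m : LeaderMsg n L F D) : Set (Tip D) := {m.tip, m.cert.block}

/-- The identifier blocks mentioned in evidence. -/
def Evidence.tips : Evidence n L F D → Set (Tip D)
  | .equivocation a b => a.tips ∪ b.tips
  | .error I S q => {some I} ∪ {X | ∃ i ∈ S, X ∈ (LeaderMsg.proposal (q i)).tips}
  | .silence _ => ∅

/-- The identifier blocks mentioned in a message. -/
def Msg.tips : Msg n L F D → Set (Tip D)
  | .signed _ (.lead m) => m.tips
  | .signed _ (.vote X _) => {X}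
  | .signed _ (.status _ c) => {c.block}
  | .signed _ (.blame _) => ∅
  | .signed _ (.quitView _ e) => e.tips
  | .follow Y _ => {some Y.ident}

end Legal

/-! ### Timed traces -/

/-- What happens in a run: who is honest, who sends which message to whom at which time, who
receives which message from whom at which time, and which statements are signed when. -/
structure Trace (n L : ℕ) (F D : Type*) where
  honest : Finset (Fin n)
  sends : Fin n → Fin n → Msg n L F D → ℝ → Prop
  receives : Fin n → Fin n → Msg n L F D → ℝ → Prop
  signs : Fin n → Stmt n L F D → ℝ → Prop

namespace Trace
variable {n f L : ℕ} {F Req D : Type*} [Field F]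
  (cfg : Config n f L F Req D) (tr : Trace n L F D)

/-- Node `r` has received `m` by time `t`. -/
def Got (r : Fin n) (m : Msg n L F D) (t : ℝ) : Prop :=
  ∃ s, ∃ t' ≤ t, tr.receives s r m t'

/-- Node `r` sends `m` to all nodes at time `t`. -/
def Broadcasts (r : Fin n) (m : Msg n L F D) (t : ℝ) : Prop :=
  ∀ j, tr.sends r j m t

/-- Node `r` has received the legal, leader-signed message `m` by time `t`. -/
def GotLead (r : Fin n) (m : LeaderMsg n L F D) (t : ℝ) : Prop :=
  m.Legal cfg ∧ tr.Got r (m.toMsg cfg) t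

/-- By time `t`, node `r` has received `f+1` proposals of view `v` with distinct segments for `I`
that decode to `B`. -/
def DecodedProposals (r : Fin n) (v : ℕ) (I : IdBlock D) (B : Block Req D) (t : ℝ) : Prop :=
  ∃ (S : Finset (Fin n)) (y : Fin n → Fin L → F),
    (∀ i ∈ S, ∃ c, tr.GotLead cfg r (.proposal ⟨⟨i, y i, I⟩, v, c⟩) t) ∧ cfg.DecodesTo S y B

/-- Node `s` distributes the segments generated from `B`, whose identifier is in `I`, with their
Merkle proofs: each node is sent its own segment. -/
def Distributes (s : Fin n) (I : IdBlock D) (B : Block Req D) (t : ℝ) : Prop :=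
  I.root = cfg.blockRoot B ∧
    ∀ i, tr.sends s i (.follow (cfg.segment B I i) (cfg.proofOf (cfg.encode B) i cfg.shape)) t

/-- The inputs on which honest nodes evaluate the hash function during the run: identifier blocks
in the messages they receive, Merkle trees of the blocks that they decode or distribute, and
Merkle proofs that they check. -/
def hashed : Set (HashInput n L F D) :=
  {x | ∃ r ∈ tr.honest, ∃ t,
    (∃ m I, tr.Got r m t ∧ some I ∈ m.tips ∧ x = I.input n L F) ∨
    (∃ v I B, tr.DecodedProposals cfg r v I B t ∧ x ∈ cfg.merkleInputs (cfg.encode B) cfg.shape) ∨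
    (∃ I B, tr.Distributes cfg r I B t ∧ x ∈ cfg.merkleInputs (cfg.encode B) cfg.shape) ∨
    (∃ Y π, tr.Got r (.follow Y π) t ∧ x ∈ cfg.recomputeInputs Y.idx Y.chunk cfg.shape π)}

/-- `X` is the predecessor of `A`: `A` contains the identifier of `X`. Only identifier blocks that
occur in the run are considered. -/
def Pred (A X : Tip D) : Prop :=
  (∃ I, A = some I ∧ cfg.Links I X) ∧ ∀ J, X = some J → J.input n L F ∈ tr.hashed cfg

/-- `A` extends `X`. -/
def Extends (A X : Tip D) : Prop := Relation.ReflTransGen (tr.Pred cfg) A X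

/-- Validity of evidence against the leader of view `v`. -/
def ValidEvidence (v : ℕ) : Evidence n L F D → Prop
  | .equivocation a b =>
      a.view = v ∧ b.view = v ∧ a.Legal cfg ∧ b.Legal cfg ∧
        ¬ tr.Extends cfg a.tip b.tip ∧ ¬ tr.Extends cfg b.tip a.tip
  | .error I S q =>
      S.card = f + 1 ∧
      (∀ i ∈ S, (LeaderMsg.proposal (q i)).Legal cfg ∧ (q i).view = v ∧
        (q i).seg.idx = i ∧ (q i).seg.ident = I) ∧
      ¬ ∃ B, cfg.DecodesTo S (fun i => (q i).seg.chunk) B ∧ I.root = cfg.blockRoot B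
  | .silence S => f + 1 ≤ S.card

/-- By time `t`, node `r` has found evidence for view `v` or has received a quit-view message with
such evidence. -/
def HasEvidence (r : Fin n) (v : ℕ) (t : ℝ) : Prop :=
  ∃ e, tr.ValidEvidence cfg v e ∧
    ((∀ m ∈ e.parts cfg v, tr.Got r m t) ∨ ∃ s, tr.Got r (.signed s (.quitView v e)) t)

/-- Node `r` has entered view `v` by time `t`: nodes start in view `0` and move from a view to the
next one as soon as they have evidence for it. -/
def Entered (r : Fin n) (v : ℕ) (t : ℝ) : Prop := ∀ u < v, tr.HasEvidence cfg r u t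

/-- Node `r` is in view `v` at time `t`. Everything received up to and including time `t` has been
processed, so messages that arrive at time `t` take precedence over timers that end at `t`. -/
def InView (r : Fin n) (v : ℕ) (t : ℝ) : Prop :=
  tr.Entered cfg r v t ∧ ¬ tr.HasEvidence cfg r v t

/-- By time `t`, node `r` holds the valid certificate `c`. -/
def HasCert (r : Fin n) (c : Cert n D) (t : ℝ) : Prop :=
  c.Valid f ∧
    (c.IsGenesis ∨ (∀ s ∈ c.signers, tr.Got r (.signed s (.vote c.block c.view)) t) ∨
      ∃ s st, tr.Got r (.signed s st) t ∧ c ∈ st.certs)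

/-- `c` is the certificate on which node `r` locks when it enters view `v`: a highest one among
those it holds at that moment. -/
def Locks (r : Fin n) (v : ℕ) (c : Cert n D) : Prop :=
  (∀ t, tr.Entered cfg r v t → tr.HasCert (f := f) r c t) ∧
    ∀ t, (∀ t' < t, ¬ tr.Entered cfg r v t') →
      ∀ c', tr.HasCert (f := f) r c' t → c'.rank ≤ c.rank

/-- The condition of the Vote step of the Steady-State phase. -/
def VoteReady (r : Fin n) (I : IdBlock D) (v : ℕ) (t : ℝ) : Prop :=
  tr.InView cfg r v t ∧ ∃ B, tr.DecodedProposals cfg r v I B t ∧ I.root = cfg.blockRoot B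

/-- The condition of the View-Start step of the View-Change phase. -/
def StartReady (r : Fin n) (c : Cert n D) (v : ℕ) (t : ℝ) : Prop :=
  tr.InView cfg r v t ∧ tr.GotLead cfg r (.newView v c) t ∧
    ∃ c₀, tr.Locks cfg r v c₀ ∧ c₀.rank ≤ c.rank

/-! #### Commitment -/

/-- By time `t`, the commit-timer of node `r` for `I_h` has run for `2Δ` in view `v` since `r` had a
proposal of view `v` for the next height, and `r` is still in view `v`. -/
def DirectlyCommits (r : Fin n) (I : IdBlock D) (v : ℕ) (t : ℝ) : Prop :=
  tr.InView cfg r v (t - 2 * cfg.Δ) ∧ tr.InView cfg r v t ∧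
    ∃ p : Proposal n L F D, tr.GotLead cfg r (.proposal p) (t - 2 * cfg.Δ) ∧
      p.view = v ∧ p.cert.block = some I

/-- By time `t`, node `r` has committed on the identifier block `I`, directly or through an
identifier block that extends `I`. -/
def CommitsId (r : Fin n) (I : IdBlock D) (t : ℝ) : Prop :=
  ∃ I' v, ∃ t' ≤ t, tr.DirectlyCommits cfg r I' v t' ∧ tr.Extends cfg (some I') (some I)

/-- By time `t`, node `r` has collected `f+1` correct follow messages with distinct segments for
`I`, and decodes `B` from them. -/
def CollectsAndDecodes (r : Fin n) (I : IdBlock D) (B : Block Req D) (t : ℝ) : Prop :=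
  ∃ (S : Finset (Fin n)) (y : Fin n → Fin L → F),
    (∀ i ∈ S, ∃ π, cfg.Correct ⟨i, y i, I⟩ π ∧ tr.Got r (.follow ⟨i, y i, I⟩ π) t) ∧
      cfg.DecodesTo S y B

/-- By time `t`, node `r` has committed on the full block `B` at height `h` in the Follow phase. -/
def CommitsBlock (r : Fin n) (h : ℕ) (B : Block Req D) (t : ℝ) : Prop :=
  ∃ I, I.height = h ∧ tr.CommitsId cfg r I t ∧ tr.CollectsAndDecodes cfg r I B t

end Trace

/-! ### Executions -/

/-- `tr` is an execution of the protocol in a synchronous network with at most `f` faulty nodes and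
unforgeable signatures. Faulty nodes are otherwise unrestricted. Honest nodes sign only what the
protocol allows and meet the obligations below. The obligations to issue proposals, new-view
messages and blames are not imposed, so executions with stalling leaders are included. -/
structure IsExecution {n f L : ℕ} {F Req D : Type*} [Field F]
    (cfg : Config n f L F Req D) (tr : Trace n L F D) : Prop where
  -- the fault, network and signature model
  faulty : n ≤ tr.honest.card + f
  start : ∀ s r m t, tr.receives s r m t → 0 ≤ t
  delivery : ∀ s ∈ tr.honest, ∀ r ∈ tr.honest, ∀ m t, tr.sends s r m t →
    ∃ t', t ≤ t' ∧ t' ≤ t + cfg.Δ ∧ tr.receives s r m t'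
  authentic : ∀ s ∈ tr.honest, ∀ r ∈ tr.honest, ∀ m t, tr.receives s r m t →
    ∃ t' ≤ t, tr.sends s r m t'
  unforgeable : ∀ s ∈ tr.honest, ∀ r ∈ tr.honest, ∀ st m t, tr.Got r m t →
    Msg.Carries cfg s st m → ∃ t' ≤ t, tr.signs s st t'
  -- what honest nodes may sign
  sign_proposal : ∀ r ∈ tr.honest, ∀ (p : Proposal n L F D) t, tr.signs r (.lead (.proposal p)) t →
    r = cfg.leader p.view ∧ 0 ≤ t ∧ tr.InView cfg r p.view t ∧
      (LeaderMsg.proposal p).Legal cfg ∧ tr.HasCert (f := f) r p.cert t ∧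
      ∃ B, B.prev = p.cert.block.map IdBlock.root ∧ p.seg.ident.root = cfg.blockRoot B ∧
        p.seg = cfg.segment B p.seg.ident p.seg.idx
  sign_proposal_once : ∀ r ∈ tr.honest, ∀ (p p' : Proposal n L F D) t t',
    tr.signs r (.lead (.proposal p)) t → tr.signs r (.lead (.proposal p')) t' →
    p.view = p'.view → p.seg.ident.height = p'.seg.ident.height → p.seg.ident = p'.seg.ident
  sign_newView : ∀ r ∈ tr.honest, ∀ v c t, tr.signs r (.lead (.newView v c)) t →
    r = cfg.leader v ∧ 0 < v ∧ c.view < v ∧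
      tr.InView cfg r v (t - 2 * cfg.Δ) ∧ tr.InView cfg r v t ∧
      tr.HasCert (f := f) r c t ∧ ∀ c', tr.HasCert (f := f) r c' t → c'.rank ≤ c.rank
  sign_newView_once : ∀ r ∈ tr.honest, ∀ v c c' t t', tr.signs r (.lead (.newView v c)) t →
    tr.signs r (.lead (.newView v c')) t' → c = c'
  sign_vote : ∀ r ∈ tr.honest, ∀ X v t, tr.signs r (.vote X v) t →
    (∃ I, X = some I ∧ tr.VoteReady cfg r I v t) ∨
      ∃ c, c.block = X ∧ tr.StartReady cfg r c v t
  sign_status : ∀ r ∈ tr.honest, ∀ v c t, tr.signs r (.status v c) t →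
    tr.Entered cfg r v t ∧ tr.Locks cfg r v c
  sign_blame : ∀ r ∈ tr.honest, ∀ v t, tr.signs r (.blame v) t →
    0 ≤ t - (3 * cfg.p + 4) * cfg.Δ ∧ tr.InView cfg r v (t - (3 * cfg.p + 4) * cfg.Δ) ∧
      tr.InView cfg r v t ∧
      ¬ ∃ V : Finset (Tip D), V.card = cfg.p ∧
        ∀ X ∈ V, ∃ t', t - (3 * cfg.p + 4) * cfg.Δ ≤ t' ∧ t' ≤ t ∧ tr.signs r (.vote X v) t'
  sign_quitView : ∀ r ∈ tr.honest, ∀ v e t, tr.signs r (.quitView v e) t →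
    tr.Entered cfg r v t ∧ tr.HasEvidence cfg r v t ∧ tr.ValidEvidence cfg v e
  -- Re-Propose: forward a proposal of each height, and one's own
  repropose : ∀ r ∈ tr.honest, ∀ (p : Proposal n L F D) t, tr.InView cfg r p.view t →
    tr.GotLead cfg r (.proposal p) t →
    ∃ p' : Proposal n L F D, p'.view = p.view ∧ p'.seg.ident.height = p.seg.ident.height ∧
      ∃ t' ≤ t, tr.GotLead cfg r (.proposal p') t' ∧
        tr.Broadcasts r ((LeaderMsg.proposal p').toMsg cfg) t'
  repropose_own : ∀ r ∈ tr.honest, ∀ (p : Proposal n L F D) t, tr.InView cfg r p.view t →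
    tr.GotLead cfg r (.proposal p) t → p.seg.idx = r →
    ∃ p' : Proposal n L F D, p'.view = p.view ∧ p'.seg.ident.height = p.seg.ident.height ∧
      p'.seg.idx = r ∧ ∃ t' ≤ t, tr.GotLead cfg r (.proposal p') t' ∧
        tr.Broadcasts r ((LeaderMsg.proposal p').toMsg cfg) t'
  -- Vote
  vote : ∀ r ∈ tr.honest, ∀ I v t, tr.VoteReady cfg r I v t →
    ∃ t' ≤ t, tr.signs r (.vote (some I) v) t' ∧
      tr.Broadcasts r (.signed r (.vote (some I) v)) t'
  -- Quit-View: broadcast (one's own or a received) quit-view message when leaving a view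
  quitView : ∀ r ∈ tr.honest, ∀ v t, tr.Entered cfg r v t → tr.HasEvidence cfg r v t →
    ∃ s e, tr.ValidEvidence cfg v e ∧ ∃ t' ≤ t, tr.Broadcasts r (.signed s (.quitView v e)) t'
  -- Status
  status : ∀ r ∈ tr.honest, ∀ v c t, 0 < v → tr.Entered cfg r v t → tr.Locks cfg r v c →
    ∃ c', tr.Locks cfg r v c' ∧ ∃ t' ≤ t, tr.signs r (.status v c') t' ∧
      tr.sends r (cfg.leader v) (.signed r (.status v c')) t'
  -- View-Start: forward the new-view message and vote
  viewStart : ∀ r ∈ tr.honest, ∀ v c t, tr.StartReady cfg r c v t →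
    ∃ t' ≤ t, tr.Broadcasts r ((LeaderMsg.newView v c).toMsg cfg) t' ∧
      tr.signs r (.vote c.block v) t' ∧ tr.Broadcasts r (.signed r (.vote c.block v)) t'
  -- Follow phase: Propose with Proof
  followPropose : ∀ r ∈ tr.honest, ∀ I v B t, tr.CommitsId cfg r I t →
    tr.DecodedProposals cfg r v I B t → I.root = cfg.blockRoot B →
    ∃ t' ≤ t, tr.Distributes cfg r I B t'
  -- Follow phase: Repropose
  followRepropose : ∀ r ∈ tr.honest, ∀ (Y : Segment n L F D) π t, tr.Got r (.follow Y π) t →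
    cfg.Correct Y π → Y.idx = r → ∃ t' ≤ t, tr.Broadcasts r (.follow Y π) t'

end Hamster

namespace Hamster

/-! ### Coding and Merkle trees -/

namespace Config
variable {n f L : ℕ} {F Req D : Type*} [Field F] (cfg : Config n f L F Req D)

/-! Safety splits into agreement on identifier blocks and the fact that an identifier block
determines its full block.

Agreement rests on what a direct commit on `J` in view `v` at time `t` forces at the midpoint `t -
Δ` (`forall_inView_of_directlyCommits`): every honest node is in `v` and holds a common proposal
carrying a certificate for `J`. Evidence of equivocation would expel a node from the view, so honest
votes of view `v` are compatible with `J`. Every lock taken on entering a later view ranks at least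
`(v, J.height)`, since the certificate is already held by then. By induction on view, and on height
inside a view, every honest vote in a later view is for an extension of `J`
(`vote_extends_of_directlyCommits`). A second commit needs a certificate, hence an honest vote, so
all commits lie on one chain (`commitsId_unique`).

For full blocks, some honest node has decoded a block `B₀` with the committed root before voting,
also when the commit is indirect. Collision-freeness makes every chunk verified against this root a
chunk of `B₀`, so every decoding yields `B₀` (`CollectsAndDecodes.eq`). The same lemma gives
uniqueness in consistent distributing; existence holds because at least `f+1` honest nodes forward
their own segments. -/

theorem sysPoint_injective : Function.Injective cfg.sysPoint :=
  cfg.point.injective.comp (Fin.castLE_injective _)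

/-- Decoding any `f+1` chunks of a block yields its layout. -/
theorem interpolate_encode (B : Block Req D) {S : Finset (Fin n)} (hS : S.card = f + 1)
    (k : Fin (f + 1)) (l : Fin L) :
    (Lagrange.interpolate S cfg.point (fun i => cfg.encode B i l)).eval (cfg.sysPoint k) =
      cfg.layout B k l := by
  have hinj : Set.InjOn cfg.sysPoint (Finset.univ : Finset (Fin (f + 1))) :=
    cfg.sysPoint_injective.injOn
  have hdeg := Lagrange.degree_interpolate_lt (fun k => cfg.layout B k l) hinj
  -- The encoding polynomial has degree below `f+1`, so its values at any `f+1` points recover it.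
  have heq := Lagrange.eq_interpolate (s := S) (v := cfg.point) cfg.point.injective.injOn
    (hdeg.trans_eq (by simp [hS]))
  simp only [encode]
  rw [← heq, Lagrange.eval_interpolate_at_node _ hinj (Finset.mem_univ k)]

theorem decodesTo_encode (B : Block Req D) {S : Finset (Fin n)} (hS : S.card = f + 1) :
    cfg.DecodesTo S (cfg.encode B) B :=
  ⟨hS, fun k l => (cfg.interpolate_encode B hS k l).symm⟩

/-- Decoding depends only on the chunks indexed by `S`, and the layout is injective. -/
theorem DecodesTo.eq_of_encode {cfg : Config n f L F Req D} {S : Finset (Fin n)}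
    {y : Fin n → Fin L → F} {B B₀ : Block Req D} (h : cfg.DecodesTo S y B)
    (hy : ∀ i ∈ S, y i = cfg.encode B₀ i) : B = B₀ := by
  apply cfg.layout.injective
  funext k l
  rw [h.2 k l, ← cfg.interpolate_encode B₀ h.1 k l]
  congr 1
  exact Lagrange.interpolate_eq_of_values_eq_on _ _ fun i hi => by rw [hy i hi]

theorem recompute_proofOf (y : Fin n → Fin L → F) (i : Fin n) (T : BinTree (Fin n))
    (hi : i ∈ T.leaves) :
    cfg.recompute i (y i) T (cfg.proofOf y i T) = some (cfg.merkleOf y T) := by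
  induction T with
  | leaf j =>
    obtain rfl : i = j := by simpa [BinTree.leaves] using hi
    simp [proofOf, recompute, merkleOf]
  | node l r ihl ihr =>
    by_cases hl : i ∈ l.leaves
    · simp [proofOf, recompute, merkleOf, hl, ihl hl]
    · have hr : i ∈ r.leaves := by
        simp only [BinTree.leaves, List.mem_append] at hi
        exact hi.resolve_left hl
      simp [proofOf, recompute, merkleOf, hl, ihr hr]

/-- Without collisions, a chunk that passes verification is the chunk in the tree. -/
theorem eq_of_recompute {H : Set (HashInput n L F D)} (hH : Set.InjOn cfg.hash H)
    (y : Fin n → Fin L → F) (i : Fin n) (z : Fin L → F) (T : BinTree (Fin n)) (π : List D)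
    (h : cfg.recompute i z T π = some (cfg.merkleOf y T))
    (hrec : cfg.recomputeInputs i z T π ⊆ H) (hmer : cfg.merkleInputs y T ⊆ H) : z = y i := by
  induction T generalizing π with
  | leaf j =>
    cases π with
    | cons d π => simp [recompute] at h
    | nil =>
      simp only [recompute] at h
      split_ifs at h with hj
      subst hj
      have := hH (hrec (by simp [recomputeInputs])) (hmer (by simp [merkleInputs]))
        (Option.some.inj h)
      injection this
  | node l r ihl ihr =>
    cases π with
    | nil => simp [recompute] at h
    | cons d π =>
      simp only [merkleInputs, Set.union_subset_iff, Set.singleton_subset_iff] at hmer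
      obtain ⟨⟨hml, hmr⟩, hmn⟩ := hmer
      -- Equal hashes at the node force equal values on the child towards `i`, and the argument
      -- descends along that path.
      by_cases hl : i ∈ l.leaves
      · simp only [recompute, recomputeInputs, if_pos hl, Option.map_eq_some_iff,
          Set.union_subset_iff, merkleOf] at h hrec
        obtain ⟨a, ha, hae⟩ := h
        have := hH (hrec.2 ⟨a, ha, rfl⟩) hmn hae
        injection this with h1 h2
        exact ihl π (by rw [ha, h1]) hrec.1 hml
      · simp only [recompute, recomputeInputs, if_neg hl, Option.map_eq_some_iff,
          Set.union_subset_iff, merkleOf] at h hrec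
        obtain ⟨a, ha, hae⟩ := h
        have := hH (hrec.2 ⟨a, ha, rfl⟩) hmn hae
        injection this with h1 h2
        exact ihr π (by rw [ha, h2]) hrec.1 hmr

theorem correct_segment (B : Block Req D) (I : IdBlock D) (hI : I.root = cfg.blockRoot B)
    (i : Fin n) :
    cfg.Correct (cfg.segment B I i) (cfg.proofOf (cfg.encode B) i cfg.shape) := by
  simp only [Correct, segment, hI, blockRoot]
  exact cfg.recompute_proofOf _ i _ (by simp [cfg.shape_leaves])

end Config

/-! ### Chains of identifier blocks -/

namespace Trace
variable {n f L : ℕ} {F Req D : Type*} [Field F]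
  {cfg : Config n f L F Req D} {tr : Trace n L F D}

theorem Got.mono {n L : ℕ} {F D : Type*} {tr : Trace n L F D} {r : Fin n}
    {m : Msg n L F D} {t t' : ℝ} (h : tr.Got r m t) (ht : t ≤ t') :
    tr.Got r m t' := by
  obtain ⟨s, u, hu, hs⟩ := h
  exact ⟨s, u, hu.trans ht, hs⟩

theorem GotLead.mono {r : Fin n} {m : LeaderMsg n L F D} {t t' : ℝ} (h : tr.GotLead cfg r m t)
    (ht : t ≤ t') : tr.GotLead cfg r m t' :=
  ⟨h.1, h.2.mono ht⟩

theorem HasEvidence.mono {r : Fin n} {v : ℕ} {t t' : ℝ} (h : tr.HasEvidence cfg r v t)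
    (ht : t ≤ t') : tr.HasEvidence cfg r v t' := by
  obtain ⟨e, he, h | ⟨s, h⟩⟩ := h
  · exact ⟨e, he, .inl fun m hm => (h m hm).mono ht⟩
  · exact ⟨e, he, .inr ⟨s, h.mono ht⟩⟩

theorem Entered.mono {r : Fin n} {v : ℕ} {t t' : ℝ} (h : tr.Entered cfg r v t)
    (ht : t ≤ t') : tr.Entered cfg r v t' :=
  fun u hu => (h u hu).mono ht

theorem Got.input_mem_hashed {r : Fin n} (hr : r ∈ tr.honest) {m : Msg n L F D} {t : ℝ}
    (h : tr.Got r m t) {I : IdBlock D} (hI : some I ∈ m.tips) :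
    I.input n L F ∈ tr.hashed cfg :=
  ⟨r, hr, t, .inl ⟨m, I, h, hI, rfl⟩⟩

theorem GotLead.cert_mem_hashed {r : Fin n} (hr : r ∈ tr.honest) {m : LeaderMsg n L F D} {t : ℝ}
    (h : tr.GotLead cfg r m t) : ∀ I, m.cert.block = some I → I.input n L F ∈ tr.hashed cfg :=
  fun I hI => h.2.input_mem_hashed hr
    (by simp [LeaderMsg.toMsg, Msg.tips, LeaderMsg.tips, hI])

/-- A received proposal exhibits the certified block as predecessor of the proposed one. -/
theorem GotLead.pred {r : Fin n} (hr : r ∈ tr.honest) {p : Proposal n L F D} {t : ℝ}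
    (h : tr.GotLead cfg r (.proposal p) t) :
    tr.Pred cfg (some p.seg.ident) p.cert.block :=
  ⟨⟨_, rfl, h.1.2.2⟩, h.cert_mem_hashed hr⟩

theorem Pred.height {A X : Tip D} (h : tr.Pred cfg A X) : A.height = X.height + 1 := by
  obtain ⟨⟨I, rfl, hI⟩, -⟩ := h
  exact hI.2

/-- Both candidates are hashed in the run, so equal hashes give equal roots and predecessors. The
height is not part of the hash input; it is recovered from the height of `A`. -/
theorem Pred.unique (hcr : Set.InjOn cfg.hash (tr.hashed cfg)) {A X Y : Tip D}
    (hX : tr.Pred cfg A X) (hY : tr.Pred cfg A Y) : X = Y := by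
  have hh : X.height = Y.height := by have := hX.height; have := hY.height; omega
  obtain ⟨⟨I, rfl, hIX⟩, hX⟩ := hX
  obtain ⟨⟨I', hI', hIY⟩, hY⟩ := hY
  obtain rfl : I = I' := Option.some.inj hI'
  have h := hIX.1.symm.trans hIY.1
  rcases X with _ | X <;> rcases Y with _ | Y
  · rfl
  · simp [Config.tipHash] at h
  · simp [Config.tipHash] at h
  · simp only [Config.tipHash, Option.map_some, Option.some.injEq] at h
    have := hcr (hX X rfl) (hY Y rfl) h
    obtain ⟨a, b, c⟩ := X
    obtain ⟨a', b', c'⟩ := Y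
    simp only [IdBlock.input, HashInput.ident.injEq] at this
    simp only [Tip.height] at hh
    rw [hh, this.1, this.2]

theorem Extends.height_le {A X : Tip D} (h : tr.Extends cfg A X) : X.height ≤ A.height := by
  induction h with
  | refl => exact le_rfl
  | tail _ h ih => have := h.height; omega

theorem Extends.eq_of_height_le {A X : Tip D} (h : tr.Extends cfg A X)
    (hh : A.height ≤ X.height) : A = X := by
  rcases Relation.ReflTransGen.cases_head h with rfl | ⟨Y, hY, hYX⟩
  · rfl
  · have := hY.height
    have := Extends.height_le hYX
    omega

theorem Extends.of_pred (hcr : Set.InjOn cfg.hash (tr.hashed cfg)) {A X Y : Tip D}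
    (h : tr.Extends cfg A Y) (hX : tr.Pred cfg A X) : A = Y ∨ tr.Extends cfg X Y := by
  rcases Relation.ReflTransGen.cases_head h with rfl | ⟨Z, hZ, hZY⟩
  · exact .inl rfl
  · rw [hX.unique hcr hZ]
    exact .inr hZY

/-- `A` and `X` lie on one chain. -/
def Compatible (cfg : Config n f L F Req D) (tr : Trace n L F D) (A X : Tip D) : Prop :=
  tr.Extends cfg A X ∨ tr.Extends cfg X A

/-- Predecessors are unique, so the ancestors of a block form a chain. -/
theorem Extends.compatible (hcr : Set.InjOn cfg.hash (tr.hashed cfg)) {A X Y : Tip D}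
    (hX : tr.Extends cfg A X) (hY : tr.Extends cfg A Y) : tr.Compatible cfg X Y :=
  Relation.ReflTransGen.total_of_right_unique (fun _ _ _ h h' => Pred.unique hcr h h') hX hY

theorem Compatible.symm {A X : Tip D} (h : tr.Compatible cfg A X) : tr.Compatible cfg X A :=
  Or.symm h

theorem Compatible.eq_of_height_eq {A X : Tip D} (h : tr.Compatible cfg A X)
    (hh : A.height = X.height) : A = X := by
  rcases h with h | h
  · exact h.eq_of_height_le hh.le
  · exact (h.eq_of_height_le hh.ge).symm

theorem Compatible.pred_right (hcr : Set.InjOn cfg.hash (tr.hashed cfg)) {A K X : Tip D}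
    (h : tr.Compatible cfg A K) (hX : tr.Pred cfg K X) : tr.Compatible cfg A X := by
  rcases h with h | h
  · exact .inl (Relation.ReflTransGen.tail h hX)
  · rcases h.of_pred hcr hX with rfl | h
    · exact .inl (.single hX)
    · exact .inr h

theorem Compatible.extends_of_height_le {A X : Tip D} (h : tr.Compatible cfg A X)
    (hh : X.height ≤ A.height) : tr.Extends cfg A X := by
  rcases h with h | h
  · exact h
  · rw [h.eq_of_height_le hh]
    exact .refl

/-- A node that stays in a view has seen no conflicting statements of its leader. -/
theorem InView.compatible {r : Fin n} {v : ℕ} {t : ℝ} (h : tr.InView cfg r v t)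
    {a b : LeaderMsg n L F D} (ha : tr.GotLead cfg r a t) (hb : tr.GotLead cfg r b t)
    (hav : a.view = v) (hbv : b.view = v) : tr.Compatible cfg a.tip b.tip := by
  by_contra hc
  rw [Compatible, not_or] at hc
  refine h.2 ⟨.equivocation a b, ⟨hav, hbv, ha.1, hb.1, hc⟩, .inl fun m hm => ?_⟩
  rcases hm with rfl | rfl
  · simpa only [LeaderMsg.toMsg, hav] using ha.2
  · simpa only [LeaderMsg.toMsg, hbv] using hb.2

/-! ### Votes -/

/-- Any one of the `f+1` decoded segments serves; its proposal brings a same-view certificate for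
the predecessor. -/
theorem VoteReady.exists_proposal {r : Fin n} {I : IdBlock D} {v : ℕ} {t : ℝ}
    (h : tr.VoteReady cfg r I v t) : ∃ p : Proposal n L F D,
      tr.GotLead cfg r (.proposal p) t ∧ p.view = v ∧ p.cert.view = v ∧ p.seg.ident = I := by
  obtain ⟨-, B, ⟨S, y, hS, hdec⟩, -⟩ := h
  obtain ⟨i, hi⟩ : S.Nonempty := by
    rw [← Finset.card_pos, hdec.1]
    omega
  obtain ⟨c, hc⟩ := hS i hi
  exact ⟨_, hc, rfl, hc.1.2.1, rfl⟩

end Trace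

/-! ### Quorums, message delivery and the origin of certificates -/

namespace IsExecution
variable {n f L : ℕ} {F Req D : Type*} [Field F]
  {cfg : Config n f L F Req D} {tr : Trace n L F D}

/-- At most `f` nodes are faulty, so `f+1` signers cannot all be. -/
theorem exists_honest_mem (hex : IsExecution cfg tr) {S : Finset (Fin n)}
    (hS : f + 1 ≤ S.card) : ∃ s ∈ S, s ∈ tr.honest := by
  by_contra! h
  have hd : Disjoint S tr.honest := Finset.disjoint_left.2 h
  have h1 := Finset.card_union_of_disjoint hd
  have h2 := Finset.card_le_univ (S ∪ tr.honest)
  rw [Fintype.card_fin] at h2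
  have := hex.faulty
  omega

theorem got_of_sends (hex : IsExecution cfg tr) {s r : Fin n} (hs : s ∈ tr.honest)
    (hr : r ∈ tr.honest) {m : Msg n L F D} {t t' : ℝ} (h : tr.sends s r m t)
    (ht : t + cfg.Δ ≤ t') : tr.Got r m t' := by
  obtain ⟨u, -, hu, hrec⟩ := hex.delivery s hs r hr m t h
  exact ⟨s, u, hu.trans ht, hrec⟩

/-- Behind a certificate from a leader there is a vote of an honest node. -/
theorem exists_vote_of_gotLead (hex : IsExecution cfg tr) {r : Fin n} (hr : r ∈ tr.honest)
    {m : LeaderMsg n L F D} {t : ℝ} (h : tr.GotLead cfg r m t) (hg : ¬ m.cert.IsGenesis) :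
    ∃ q ∈ tr.honest, ∃ τ, tr.signs q (.vote m.cert.block m.cert.view) τ := by
  have hv : m.cert.Valid f := by
    rcases m with p | ⟨v, c⟩
    · exact h.1.1
    · exact h.1.1
  obtain ⟨q, hqS, hq⟩ := hex.exists_honest_mem (hv.resolve_left hg)
  obtain ⟨τ, -, hτ⟩ := hex.unforgeable q hq r hr _ _ t h.2
    (.cert _ (.lead m) m.cert (by simp [Stmt.certs]) hqS rfl)
  exact ⟨q, hq, τ, hτ⟩

/-- A block with an honest vote has been decoded by an honest node before a Vote step. -/
theorem exists_voteReady_of_vote (hex : IsExecution cfg tr) (v : ℕ) :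
    ∀ q ∈ tr.honest, ∀ I τ, tr.signs q (.vote (some I) v) τ →
      ∃ q' ∈ tr.honest, ∃ v' τ', tr.VoteReady cfg q' I v' τ' := by
  induction v using Nat.strong_induction_on with
  | _ v ih =>
    intro q hq I τ hs
    rcases hex.sign_vote q hq _ v τ hs with ⟨I', hI', hvr⟩ | ⟨c, hc, hst⟩
    · obtain rfl := Option.some.inj hI'
      exact ⟨q, hq, v, τ, hvr⟩
    -- A View-Start vote repeats a certificate from a strictly earlier view, so the induction ends
    -- at a Vote step; the initial certificate is excluded because it certifies `⊥`.
    · obtain ⟨q', hq', τ', hs'⟩ := hex.exists_vote_of_gotLead hq hst.2.1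
        (fun hg => by cases hg.1.symm.trans hc)
      simp only [LeaderMsg.cert, hc] at hs'
      exact ih c.view hst.2.1.1.2 q' hq' I τ' hs'

theorem exists_voteReady_of_gotLead (hex : IsExecution cfg tr) {r : Fin n} (hr : r ∈ tr.honest)
    {m : LeaderMsg n L F D} {t : ℝ} (h : tr.GotLead cfg r m t) {I : IdBlock D}
    (hI : m.cert.block = some I) :
    ∃ q ∈ tr.honest, ∃ v τ, tr.VoteReady cfg q I v τ := by
  obtain ⟨q, hq, τ, hs⟩ := hex.exists_vote_of_gotLead hr h (fun hg => by simp [hg.1] at hI)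
  rw [hI] at hs
  exact hex.exists_voteReady_of_vote _ q hq I τ hs

/-- Every ancestor of a block that was ready for an honest vote was ready for an honest vote. -/
theorem exists_voteReady_of_extends (hex : IsExecution cfg tr)
    (hcr : Set.InjOn cfg.hash (tr.hashed cfg)) {A X : Tip D} (h : tr.Extends cfg A X) :
    ∀ I, X = some I → (∀ J, A = some J → ∃ q ∈ tr.honest, ∃ v τ, tr.VoteReady cfg q J v τ) →
      ∃ q ∈ tr.honest, ∃ v τ, tr.VoteReady cfg q I v τ := by
  induction h using Relation.ReflTransGen.head_induction_on with
  | refl => exact fun I hI hA => hA I hI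
  | head hAY _ ih =>
    intro I hI hA
    refine ih I hI fun J hJ => ?_
    obtain ⟨K, rfl, -⟩ := hAY.1
    obtain ⟨q, hq, v, τ, hvr⟩ := hA K rfl
    obtain ⟨p, hp, -, -, rfl⟩ := hvr.exists_proposal
    exact hex.exists_voteReady_of_gotLead hq hp (((hp.pred hq).unique hcr hAY).trans hJ)

/-! ### Agreement on identifier blocks -/

/-- What a direct commit at `t` guarantees a time `Δ` earlier: all honest nodes are still in the
view and hold a proposal on top of the committed block. -/
theorem forall_inView_of_directlyCommits (hex : IsExecution cfg tr)
    (hcr : Set.InjOn cfg.hash (tr.hashed cfg)) {r : Fin n} (hr : r ∈ tr.honest)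
    {J : IdBlock D} {v : ℕ} {t : ℝ} (h : tr.DirectlyCommits cfg r J v t) :
    ∃ p : Proposal n L F D, p.view = v ∧ p.cert.block = some J ∧
      ∀ q ∈ tr.honest, tr.InView cfg q v (t - cfg.Δ) ∧
        tr.GotLead cfg q (.proposal p) (t - cfg.Δ) := by
  obtain ⟨hin, hin', p, hp, rfl, hJ⟩ := h
  obtain ⟨p', hpv, hph, t', ht', hp', hb⟩ := hex.repropose r hr p _ hin hp
  have hp'' := hp'.mono ht'
  -- The forwarded proposal may carry another segment, but a different identifier block of this
  -- height would be equivocation.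
  have hid : some p'.seg.ident = some p.seg.ident :=
    (hin.compatible hp'' hp hpv rfl).eq_of_height_eq hph
  have hJ' : p'.cert.block = some J := by
    have h1 := hp''.pred hr
    rw [hid] at h1
    rw [← hJ]
    exact h1.unique hcr (hp.pred hr)
  -- The first `Δ` of the commit timer: quit-view messages broadcast by `r` up to `t - 2Δ` bring
  -- everyone into the view.
  have hent : ∀ q ∈ tr.honest, tr.Entered cfg q p.view (t - cfg.Δ) := fun q hq u hu => by
    obtain ⟨s, e, he, τ, hτ, hbe⟩ := hex.quitView r hr u _
      (fun w hw => hin.1 w (hw.trans hu)) (hin.1 u hu)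
    exact ⟨e, he, .inr ⟨s, hex.got_of_sends hr hq (hbe q) (by linarith)⟩⟩
  refine ⟨p', hpv, hJ', fun q hq => ⟨⟨hent q hq, fun hev => ?_⟩, hp'.1, ?_⟩⟩
  -- The second `Δ`: had `q` left by `t - Δ`, its quit-view message would have expelled `r` by `t`.
  · obtain ⟨s, e, he, τ, hτ, hbe⟩ := hex.quitView q hq p.view _ (hent q hq) hev
    exact hin'.2 ⟨e, he, .inr ⟨s, hex.got_of_sends hq hr (hbe r) (by linarith)⟩⟩
  · exact hex.got_of_sends hr hq (hb q) (by linarith)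

/-- A leader's statement seen by an honest node inside the view of a direct commit is compatible
with the committed block. -/
theorem compatible_of_directlyCommits (hex : IsExecution cfg tr)
    (hcr : Set.InjOn cfg.hash (tr.hashed cfg)) {r : Fin n} (hr : r ∈ tr.honest)
    {J : IdBlock D} {v : ℕ} {t : ℝ} (h : tr.DirectlyCommits cfg r J v t)
    {q : Fin n} (hq : q ∈ tr.honest) {m : LeaderMsg n L F D} {τ : ℝ} (hm : tr.GotLead cfg q m τ)
    (hmv : m.view = v) (hin : tr.InView cfg q v τ) : tr.Compatible cfg m.tip (some J) := by
  obtain ⟨p, hpv, hJ, hall⟩ := hex.forall_inView_of_directlyCommits hcr hr h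
  obtain ⟨hin', hp⟩ := hall q hq
  have hc : tr.Compatible cfg m.tip (some p.seg.ident) := by
    -- At the later of the two times `q` holds both statements and is still in the view.
    rcases le_total τ (t - cfg.Δ) with hle | hle
    · exact hin'.compatible (hm.mono hle) hp hmv hpv
    · exact hin.compatible hm (hp.mono hle) hmv hpv
  exact hc.pred_right hcr (hJ ▸ hp.pred hq)

/-- Honest votes in the view of a direct commit. -/
theorem vote_compatible_of_directlyCommits (hex : IsExecution cfg tr)
    (hcr : Set.InjOn cfg.hash (tr.hashed cfg)) {r : Fin n} (hr : r ∈ tr.honest)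
    {J : IdBlock D} {v : ℕ} {t : ℝ} (h : tr.DirectlyCommits cfg r J v t)
    {q : Fin n} (hq : q ∈ tr.honest) {X : Tip D} {τ : ℝ} (hX : tr.signs q (.vote X v) τ) :
    tr.Compatible cfg X (some J) := by
  rcases hex.sign_vote q hq X v τ hX with ⟨I, rfl, hvr⟩ | ⟨c, rfl, hst⟩
  · obtain ⟨p, hp, hpv, -, rfl⟩ := hvr.exists_proposal
    exact hex.compatible_of_directlyCommits hcr hr h hq hp hpv hvr.1
  · exact hex.compatible_of_directlyCommits hcr hr h hq hst.2.1 rfl hst.1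

/-- After a direct commit, honest nodes lock on certificates at least as high when they enter a
later view. -/
theorem rank_le_of_locks (hex : IsExecution cfg tr)
    (hcr : Set.InjOn cfg.hash (tr.hashed cfg)) {r : Fin n} (hr : r ∈ tr.honest)
    {J : IdBlock D} {v : ℕ} {t : ℝ} (h : tr.DirectlyCommits cfg r J v t)
    {q : Fin n} (hq : q ∈ tr.honest) {w : ℕ} (hw : v < w) {c : Cert n D}
    (hc : tr.Locks cfg q w c) : toLex (v, J.height) ≤ c.rank := by
  obtain ⟨p, hpv, hJ, hall⟩ := hex.forall_inView_of_directlyCommits hcr hr h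
  obtain ⟨hin, hp⟩ := hall q hq
  -- Entering `w` before `t - Δ` would require evidence for `v`, which `q` lacks even at `t - Δ`.
  have hle := hc.2 (t - cfg.Δ) (fun t' ht' he => hin.2 ((he v hw).mono ht'.le)) p.cert
    ⟨hp.1.1, .inr (.inr ⟨_, _, hp.2, by simp [Stmt.certs, LeaderMsg.cert]⟩)⟩
  simpa [Cert.rank, hJ, hp.1.2.1, hpv, Tip.height] using hle

theorem height_pos_of_voteReady {q : Fin n} {I : IdBlock D} {v : ℕ} {τ : ℝ}
    (h : tr.VoteReady cfg q I v τ) : 0 < I.height := by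
  obtain ⟨p, hp, -, -, rfl⟩ := h.exists_proposal
  have := hp.1.2.2.2
  omega

theorem exists_voteReady_of_directlyCommits (hex : IsExecution cfg tr) {r : Fin n}
    (hr : r ∈ tr.honest) {J : IdBlock D} {v : ℕ} {t : ℝ}
    (h : tr.DirectlyCommits cfg r J v t) : ∃ q ∈ tr.honest, ∃ v τ, tr.VoteReady cfg q J v τ := by
  obtain ⟨-, -, p, hp, -, hJ⟩ := h
  exact hex.exists_voteReady_of_gotLead hr hp hJ

/-- Honest votes in views after a direct commit are for extensions of the committed block. -/
theorem vote_extends_of_directlyCommits (hex : IsExecution cfg tr)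
    (hcr : Set.InjOn cfg.hash (tr.hashed cfg)) {r : Fin n} (hr : r ∈ tr.honest)
    {J : IdBlock D} {v : ℕ} {t : ℝ} (h : tr.DirectlyCommits cfg r J v t) (w : ℕ) (hw : v < w) :
    ∀ q ∈ tr.honest, ∀ X τ, tr.signs q (.vote X w) τ → tr.Extends cfg X (some J) := by
  -- Needed when `v = 0`: the initial certificate has rank `(0, 0)` and must rank below `J`.
  have hpos : 0 < J.height := by
    obtain ⟨_, -, _, _, hvr⟩ := hex.exists_voteReady_of_directlyCommits hr h
    exact height_pos_of_voteReady hvr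
  induction w using Nat.strong_induction_on with
  | _ w ihw =>
    intro q hq X
    -- A Vote-step vote rests on a certificate of the same view for the predecessor, so the view
    -- alone does not decrease.
    induction hh : X.height using Nat.strong_induction_on generalizing q X with
    | _ k ihk =>
      intro τ hs
      rcases hex.sign_vote q hq X w τ hs with ⟨I, rfl, hvr⟩ | ⟨c, rfl, hst⟩
      · obtain ⟨p, hp, -, hcv, rfl⟩ := hvr.exists_proposal
        obtain ⟨q', hq', τ', hs'⟩ := hex.exists_vote_of_gotLead hq hp
          (fun hg => by have := hg.2.symm.trans hcv; omega)
        simp only [LeaderMsg.cert, hcv] at hs'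
        have hpred := hp.pred hq
        have := hpred.height
        exact .head hpred (ihk _ (by omega) q' hq' _ rfl τ' hs')
      · obtain ⟨-, hnv, c₀, hl, hle⟩ := hst
        have hrank := (hex.rank_le_of_locks hcr hr h hq hw hl).trans hle
        rw [Cert.rank, Prod.Lex.toLex_le_toLex] at hrank
        obtain ⟨q', hq', τ', hs'⟩ := hex.exists_vote_of_gotLead hq hnv (fun hg => by
          obtain ⟨hb, hv⟩ := hg
          simp only [LeaderMsg.cert] at hb hv
          simp only [hb, hv, Tip.height] at hrank
          omega)
        simp only [LeaderMsg.cert] at hs'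
        -- A certificate from a view strictly between `v` and `w` falls under the induction on
        -- views; one from `v` itself is compatible with `J` and at least as high.
        rcases hrank with hlt | ⟨heq, hhe⟩
        · exact ihw c.view hnv.1.2 hlt q' hq' _ τ' hs'
        · have heq : v = c.view := heq
          rw [← heq] at hs'
          exact (hex.vote_compatible_of_directlyCommits hcr hr h hq' hs').extends_of_height_le hhe

/-- The later commit rests on a certificate of its own view, hence on an honest vote there, which
the earlier commit constrains. -/
theorem directlyCommits_compatible_of_le (hex : IsExecution cfg tr)
    (hcr : Set.InjOn cfg.hash (tr.hashed cfg)) {r r' : Fin n} (hr : r ∈ tr.honest)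
    (hr' : r' ∈ tr.honest) {J J' : IdBlock D} {v v' : ℕ} {t t' : ℝ}
    (h : tr.DirectlyCommits cfg r J v t) (h' : tr.DirectlyCommits cfg r' J' v' t')
    (hv : v ≤ v') : tr.Compatible cfg (some J') (some J) := by
  obtain ⟨-, -, p, hp, hpv, hJ'⟩ := h'
  obtain ⟨q, hq, τ, hs⟩ := hex.exists_vote_of_gotLead hr' hp
    (fun hg => by cases hg.1.symm.trans hJ')
  simp only [LeaderMsg.cert, hJ', hp.1.2.1, hpv] at hs
  rcases hv.eq_or_lt with rfl | hlt
  · exact hex.vote_compatible_of_directlyCommits hcr hr h hq hs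
  · exact .inl (hex.vote_extends_of_directlyCommits hcr hr h v' hlt q hq _ τ hs)

/-- Both blocks are ancestors of the higher of two compatible directly committed blocks, and a chain
has one block per height. -/
theorem commitsId_unique (hex : IsExecution cfg tr)
    (hcr : Set.InjOn cfg.hash (tr.hashed cfg)) {r r' : Fin n} (hr : r ∈ tr.honest)
    (hr' : r' ∈ tr.honest) {I I' : IdBlock D} {t t' : ℝ} (h : tr.CommitsId cfg r I t)
    (h' : tr.CommitsId cfg r' I' t') (hh : I.height = I'.height) : I = I' := by
  obtain ⟨J, v, u, -, hd, he⟩ := h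
  obtain ⟨J', v', u', -, hd', he'⟩ := h'
  have hc : tr.Compatible cfg (some J) (some J') := by
    rcases le_total v v' with hv | hv
    · exact (hex.directlyCommits_compatible_of_le hcr hr hr' hd hd' hv).symm
    · exact hex.directlyCommits_compatible_of_le hcr hr' hr hd' hd hv
  have hc' : tr.Compatible cfg (some I) (some I') := by
    rcases hc with hc | hc
    · exact he.compatible hcr (hc.trans he')
    · exact Trace.Extends.compatible hcr (hc.trans he) he'
  exact Option.some.inj (hc'.eq_of_height_eq hh)

/-- Supplies a full block decoded by an honest node behind each committed identifier block, the
reference for comparing decodings. -/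
theorem exists_voteReady_of_commitsId (hex : IsExecution cfg tr)
    (hcr : Set.InjOn cfg.hash (tr.hashed cfg)) {r : Fin n} (hr : r ∈ tr.honest) {I : IdBlock D}
    {t : ℝ} (h : tr.CommitsId cfg r I t) : ∃ q ∈ tr.honest, ∃ v τ, tr.VoteReady cfg q I v τ := by
  obtain ⟨J, v, u, -, hd, he⟩ := h
  refine hex.exists_voteReady_of_extends hcr he I rfl fun K hK => ?_
  obtain rfl := Option.some.inj hK
  exact hex.exists_voteReady_of_directlyCommits hr hd

end IsExecution

/-! ### Full blocks -/

namespace Trace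
variable {n f L : ℕ} {F Req D : Type*} [Field F]
  {cfg : Config n f L F Req D} {tr : Trace n L F D}

/-- Both the Merkle tree of `B₀` and the checks made by `r` are among the collision-free inputs, so
each verified chunk is the encoded chunk of `B₀`. -/
theorem CollectsAndDecodes.eq (hcr : Set.InjOn cfg.hash (tr.hashed cfg)) {r : Fin n}
    (hr : r ∈ tr.honest) {I : IdBlock D} {B B₀ : Block Req D} {t : ℝ}
    (h : tr.CollectsAndDecodes cfg r I B t) (hroot : I.root = cfg.blockRoot B₀)
    (hB₀ : cfg.merkleInputs (cfg.encode B₀) cfg.shape ⊆ tr.hashed cfg) : B = B₀ := by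
  obtain ⟨S, y, hS, hdec⟩ := h
  refine hdec.eq_of_encode fun i hi => ?_
  obtain ⟨π, hcorr, hgot⟩ := hS i hi
  refine cfg.eq_of_recompute hcr (cfg.encode B₀) i (y i) cfg.shape π ?_ (fun x hx => ?_) hB₀
  · rw [Config.Correct, hroot] at hcorr
    exact hcorr
  · exact ⟨r, hr, t, .inr (.inr (.inr ⟨_, π, hgot, hx⟩))⟩

end Trace

/-- Since `n > 2f`, the honest nodes alone provide `f+1` distinct segments. -/
theorem IsExecution.exists_collectsAndDecodes {n f L : ℕ} {F Req D : Type*} [Field F]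
    {cfg : Config n f L F Req D} {tr : Trace n L F D} (hex : IsExecution cfg tr) {s r : Fin n}
    (hs : s ∈ tr.honest) (hr : r ∈ tr.honest) {I : IdBlock D} {B : Block Req D} {t : ℝ}
    (h : tr.Distributes cfg s I B t) : ∃ t', tr.CollectsAndDecodes cfg r I B t' := by
  have hcard : f + 1 ≤ tr.honest.card := by
    have := hex.faulty
    have := cfg.resilience
    omega
  obtain ⟨S, hSh, hS⟩ := Finset.exists_subset_card_eq hcard
  -- One `Δ` for each honest node to receive its own segment, one more for the forwarded copy to
  -- arrive.
  refine ⟨t + cfg.Δ + cfg.Δ, S, cfg.encode B, fun i hi => ⟨_, cfg.correct_segment B I h.1 i, ?_⟩,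
    cfg.decodesTo_encode B hS⟩
  obtain ⟨u, hu, hb⟩ := hex.followRepropose i (hSh hi) _ _ (t + cfg.Δ)
    (hex.got_of_sends hs (hSh hi) (h.2 i) le_rfl) (cfg.correct_segment B I h.1 i) rfl
  exact hex.got_of_sends (hSh hi) hr (hb r) (by linarith)

end Hamster

theorem mainTheorem2 {n f L : ℕ} {F Req D : Type*} [Field F]
    (cfg : Hamster.Config n f L F Req D) (tr : Hamster.Trace n L F D)
    (hex : Hamster.IsExecution cfg tr)
    (hcr : Set.InjOn cfg.hash (tr.hashed cfg)) :
    (∀ r ∈ tr.honest, ∀ r' ∈ tr.honest, ∀ h B B' t t',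
      tr.CommitsBlock cfg r h B t → tr.CommitsBlock cfg r' h B' t' → B = B') ∧
    (∀ s ∈ tr.honest, ∀ I B t, tr.Distributes cfg s I B t →
      ∀ r ∈ tr.honest, (∃ t', tr.CollectsAndDecodes cfg r I B t') ∧
        ∀ B' t', tr.CollectsAndDecodes cfg r I B' t' → B' = B) := by
  refine ⟨fun r hr r' hr' h B B' t t' hB hB' => ?_, fun s hs I B t hd r hr =>
    ⟨hex.exists_collectsAndDecodes hs hr hd, fun B' t' hB' => ?_⟩⟩
  · obtain ⟨I, hI, hc, hB⟩ := hB
    obtain ⟨I', hI', hc', hB'⟩ := hB'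
    obtain rfl := hex.commitsId_unique hcr hr hr' hc hc' (hI.trans hI'.symm)
    -- `B₀` is decoded by some honest voter, not necessarily `r` or `r'`; both committed blocks are
    -- compared with it.
    obtain ⟨q, hq, v, τ, -, B₀, hdec, hroot⟩ := hex.exists_voteReady_of_commitsId hcr hr hc
    have hsub : cfg.merkleInputs (cfg.encode B₀) cfg.shape ⊆ tr.hashed cfg :=
      fun x hx => ⟨q, hq, τ, .inr (.inl ⟨v, I, B₀, hdec, hx⟩)⟩
    exact (hB.eq hcr hr hroot hsub).trans (hB'.eq hcr hr' hroot hsub).symm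
  · exact hB'.eq hcr hr hd.1 fun x hx => ⟨s, hs, t, .inr (.inr (.inl ⟨I, B, hd, hx⟩))⟩
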